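/- Let $F=\langle x_0,x_1,x_2,\ldots \mid x_jx_i=x_ix_{j+1}\ (0\le i<j)\rangle$ be Thompson's group, and let $\Gamma$ be its (left or right) Cayley graph with respect to the generating set $A=\{x_0,x_1,x_2\}$, so that six directed edges, labelled by $A^{\pm1}$, start at each vertex. For a finite nonempty set $Y$ of vertices let the density $\delta(Y)$ be the average vertex degree of the subgraph of $\Gamma$ induced on $Y$, and let $\partial_*Y$ be the set of directed edges that go from a vertex in $Y$ to a vertex outside $Y$. Then the Cheeger isoperimetric constant of $\Gamma$ is strictly less than $1$: $$\iota_*(F;A)=\inf_{Y}\frac{|\partial_*Y|}{|Y|}<1 .$$ Equivalently (since $\delta(Y)+|\partial_*Y|/|Y|=6$), the density of $\Gamma$ strictly exceeds $5$: $\sup_Y\delta(Y)>5$. More precisely, there is a finite nonempty $Y$ with $\delta(Y)>5+\frac1{1200}$. -/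

import Mathlib

noncomputable section

/-! ### Thompson's group `F` -/

/-- The relators `x_j x_i = x_i x_{j+1}` (`0 ≤ i < j`). -/
def thompsonRels : Set (FreeGroup ℕ) :=
  {r | ∃ i j : ℕ, i < j ∧
    r = (FreeGroup.of j * FreeGroup.of i) * (FreeGroup.of i * FreeGroup.of (j + 1))⁻¹}

/-- Thompson's group `F = ⟨x_0, x_1, x_2, … ∣ x_j x_i = x_i x_{j+1} (0 ≤ i < j)⟩`. -/
abbrev ThompsonF : Type := PresentedGroup thompsonRels

/-- The generator `x_n` of `F`. -/
def ThompsonF.x (n : ℕ) : ThompsonF := PresentedGroup.of n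

/-! ### Graphs in the sense of Serre -/

universe u v

/-- A graph in the sense of Serre: every geometric edge consists of two distinct, mutually inverse
directed edges. -/
structure SerreGraph where
  /-- vertices -/
  V : Type u
  /-- directed edges -/
  E : Type v
  /-- the inverse edge -/
  rev : E → E
  /-- the initial vertex -/
  src : E → V
  /-- the terminal vertex -/
  tgt : E → V
  rev_ne : ∀ e, rev e ≠ e
  rev_rev : ∀ e, rev (rev e) = e
  src_rev : ∀ e, src (rev e) = tgt e
  tgt_rev : ∀ e, tgt (rev e) = src e

namespace SerreGraph

variable (Γ : SerreGraph.{u, v})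

/-! A finite set `Y` of vertices stands for the subgraph with all edges that connect vertices
of `Y`. The notions below are meant for graphs in which finitely many edges start at each vertex. -/

/-- The degree of the vertex `w` in the subgraph `Y`: the number of directed edges that start
at `w` and end in `Y`. -/
def degreeIn (Y : Finset Γ.V) (w : Γ.V) : ℕ :=
  {e : Γ.E | Γ.src e = w ∧ Γ.tgt e ∈ Y}.ncard

/-- The density of the subgraph `Y`: its average vertex degree. -/
def densityOf (Y : Finset Γ.V) : ℝ :=
  (∑ w ∈ Y, (Γ.degreeIn Y w : ℝ)) / (Y.card : ℝ)

/-- The Cheeger boundary of `Y`: the directed edges from a vertex of `Y` to a vertex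
outside `Y`. -/
def cheegerBoundary (Y : Finset Γ.V) : Set Γ.E :=
  {e | Γ.src e ∈ Y ∧ Γ.tgt e ∉ Y}

/-- The Cheeger isoperimetric constant of the subgraph `Y`: the size of the Cheeger boundary
divided by the number of vertices. -/
def cheegerOf (Y : Finset Γ.V) : ℝ :=
  ((Γ.cheegerBoundary Y).ncard : ℝ) / (Y.card : ℝ)

/-- The density of the graph: the supremum of the densities of its finite nonempty subgraphs. -/
def density : ℝ := ⨆ Y : {Y : Finset Γ.V // Y.Nonempty}, Γ.densityOf Y.1

/-- The Cheeger isoperimetric constant of the graph: the infimum of the Cheeger isoperimetric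
constants of its finite nonempty subgraphs. -/
def cheegerConstant : ℝ := ⨅ Y : {Y : Finset Γ.V // Y.Nonempty}, Γ.cheegerOf Y.1

end SerreGraph

/-! ### Cayley graphs -/

section Cayley

variable {G : Type u} [Group G]

/-- The letters of `A^{±1}`: `(a, true)` stands for `a` and `(a, false)` for `a⁻¹`. -/
abbrev Letter (A : Set G) : Type u := A × Bool

namespace Letter

variable {A : Set G}

/-- The element of the group represented by a letter. -/
def val (l : Letter A) : G := if l.2 then (l.1 : G) else (l.1 : G)⁻¹

/-- The inverse letter. -/
def opp (l : Letter A) : Letter A := (l.1, !l.2)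

theorem opp_ne (l : Letter A) : opp l ≠ l := by
  rcases l with ⟨a, _ | _⟩ <;> simp [opp]

theorem opp_opp (l : Letter A) : opp (opp l) = l := by
  rcases l with ⟨a, _ | _⟩ <;> simp [opp]

theorem val_opp (l : Letter A) : val (opp l) = (val l)⁻¹ := by
  rcases l with ⟨a, _ | _⟩ <;> simp [opp, val]

end Letter

/-- The right Cayley graph: the edge `(g, l)` with label `l ∈ A^{±1}` goes from `g` to `g l`. -/
def rightCayleyGraph (A : Set G) : SerreGraph.{u, u} where
  V := G
  E := G × Letter A
  rev e := (e.1 * e.2.val, e.2.opp)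
  src e := e.1
  tgt e := e.1 * e.2.val
  rev_ne e h := Letter.opp_ne e.2 (congrArg Prod.snd h)
  rev_rev e := by simp [Letter.val_opp, Letter.opp_opp]
  src_rev _ := rfl
  tgt_rev e := by simp [Letter.val_opp]

/-- The left Cayley graph: the edge `(l, g)` with label `l ∈ A^{±1}` goes from `l g` to `g`. -/
def leftCayleyGraph (A : Set G) : SerreGraph.{u, u} where
  V := G
  E := Letter A × G
  rev e := (e.1.opp, e.1.val * e.2)
  src e := e.1.val * e.2
  tgt e := e.2
  rev_ne e h := Letter.opp_ne e.1 (congrArg Prod.fst h)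
  rev_rev e := by simp [Letter.val_opp, Letter.opp_opp]
  src_rev e := by simp [Letter.val_opp]
  tgt_rev _ := rfl

end Cayley

/-- The set `{x_0, x_1, x_2}` of elements of `F`. -/
def ThompsonF.gens012 : Set ThompsonF := {ThompsonF.x 0, ThompsonF.x 1, ThompsonF.x 2}

/-- The set `{x_0, x_1, x_2}` generates `F`. -/
theorem ThompsonF.closure_gens012 : Subgroup.closure ThompsonF.gens012 = ⊤ := by
  have hrel : ∀ i j : ℕ, i < j →
      ThompsonF.x j * ThompsonF.x i = ThompsonF.x i * ThompsonF.x (j + 1) := by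
    intro i j hij
    have h := PresentedGroup.one_of_mem (rels := thompsonRels) ⟨i, j, hij, rfl⟩
    rw [map_mul, map_inv, mul_inv_eq_one, map_mul, map_mul] at h
    exact h
  have h0 : ThompsonF.x 0 ∈ Subgroup.closure ThompsonF.gens012 :=
    Subgroup.subset_closure (by simp [ThompsonF.gens012])
  have h1 : ∀ n, ThompsonF.x (n + 1) ∈ Subgroup.closure ThompsonF.gens012 := by
    intro n
    induction n with
    | zero => exact Subgroup.subset_closure (by simp [ThompsonF.gens012])
    | succ n ih =>
      have h : ThompsonF.x (n + 1 + 1) =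
          (ThompsonF.x 0)⁻¹ * (ThompsonF.x (n + 1) * ThompsonF.x 0) := by
        rw [hrel 0 (n + 1) (Nat.succ_pos n), inv_mul_cancel_left]
      rw [h]
      exact mul_mem (inv_mem h0) (mul_mem ih h0)
  rw [eq_top_iff, ← PresentedGroup.closure_range_of thompsonRels, Subgroup.closure_le]
  rintro _ ⟨n, rfl⟩
  cases n with
  | zero => exact h0
  | succ n => exact h1 n

end

/-! Elements of `F` are represented by forests with a marker: left multiplication by `x 0` moves the
marker over one tree, `x 1` joins the first two trees after it, `x 2` the second and third. These
moves keep the number of leaves, and for a fixed number of leaves distinct marked forests give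
distinct elements (`val_injOn`). So it suffices to find a dense family of marked forests under these
moves.

Let `S` and `S'` be the trees of height at most `k + 1` and `k`. Weight a forest with `n` leaves by
`t ^ n`, where `t` is close to `1/4` and chosen so that `S` has weight `1`. From `1 = t + a ^ 2` the
weight `a` of `S'` is about `√3 / 2`. Among all forests with boundedly many trees from `S`, up to a
boundary error, the edges `x 0`, `x 1`, `x 2` have relative masses `1`, `a ^ 2`, `a ^ 2`, hence
density about `2 (1 + 3/4 + 3/4) = 5`.

The gain comes from deleting vertices of low degree. If the trees around the marker read nil, `T`,
nil, `U` with `T`, `U` of full height, then at each of the three marker positions in `alternating`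
at most three edges remain: two along `x 0` and one that splits `T` or `U`. Three successive
positions share two `x 0` edges, so their removal destroys at most `9 - 2 = 7` edges, fewer than the
`3 * 5 / 2` that density `5` would allot. The gain is about `(t (1 - a)) ^ 2 > 1/1200`
(`le_mass_rich`, `exists_dense_mass`). A pigeonhole over the number of leaves turns masses into
cardinalities. -/

namespace SerreGraph

/-! ### Density and Cheeger constant of regular graphs. -/

variable {Γ : SerreGraph.{u, v}}

theorem ncard_cheegerBoundary (hfin : ∀ w, {e | Γ.src e = w}.Finite) (Y : Finset Γ.V) :
    (Γ.cheegerBoundary Y).ncard = ∑ w ∈ Y, {e | Γ.src e = w ∧ Γ.tgt e ∉ Y}.ncard := by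
  classical
  have hB : (Γ.cheegerBoundary Y).Finite :=
    (Y.finite_toSet.biUnion fun w _ => hfin w).subset fun e he =>
      Set.mem_biUnion (Finset.mem_coe.2 he.1) rfl
  rw [Set.ncard_eq_toFinset_card _ hB,
    Finset.card_eq_sum_card_fiberwise (f := Γ.src) (t := Y) fun e he => by
      simpa using ((Set.Finite.mem_toFinset hB).1 he).1]
  refine Finset.sum_congr rfl fun w hw => ?_
  rw [← Set.ncard_coe_finset]
  congr 1
  ext e
  simp only [Finset.coe_filter, Set.Finite.mem_toFinset, cheegerBoundary, Set.mem_ofPred_eq]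
  constructor
  · rintro ⟨⟨-, h⟩, h'⟩
    exact ⟨h', h⟩
  · rintro ⟨rfl, h⟩
    exact ⟨⟨hw, h⟩, rfl⟩

/-- In a `d`-regular graph, density and Cheeger constant of a finite subgraph add up to `d`. -/
theorem densityOf_add_cheegerOf {d : ℕ} (hfin : ∀ w, {e | Γ.src e = w}.Finite)
    (hd : ∀ w, {e | Γ.src e = w}.ncard = d) {Y : Finset Γ.V} (hY : Y.Nonempty) :
    Γ.densityOf Y + Γ.cheegerOf Y = d := by
  have key : ∀ w, Γ.degreeIn Y w + {e | Γ.src e = w ∧ Γ.tgt e ∉ Y}.ncard = d := by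
    intro w
    rw [← hd w, degreeIn, ← Set.ncard_union_eq (Set.disjoint_left.2 fun e h h' => h'.2 h.2)
      ((hfin w).subset fun e h => h.1) ((hfin w).subset fun e h => h.1)]
    congr 1
    ext e
    simp only [Set.mem_union, Set.mem_ofPred_eq]
    tauto
  have hc : (Y.card : ℝ) ≠ 0 := by
    exact_mod_cast hY.card_pos.ne'
  rw [densityOf, cheegerOf, ncard_cheegerBoundary hfin, ← add_div, div_eq_iff hc]
  push_cast
  rw [← Finset.sum_add_distrib, mul_comm, ← nsmul_eq_mul, ← Finset.sum_const]
  exact Finset.sum_congr rfl fun w _ => by exact_mod_cast key w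

/-- A dense finite subgraph of a `d`-regular graph bounds the density of the graph from below and
its Cheeger constant from above. -/
theorem cheegerConstant_lt_and_lt_density {d : ℕ} (hfin : ∀ w, {e | Γ.src e = w}.Finite)
    (hd : ∀ w, {e | Γ.src e = w}.ncard = d) {Y : Finset Γ.V} (hY : Y.Nonempty) {c : ℝ}
    (hc : c < Γ.densityOf Y) : Γ.cheegerConstant < d - c ∧ c < Γ.density := by
  have hsum := fun (Y : {Y : Finset Γ.V // Y.Nonempty}) => densityOf_add_cheegerOf hfin hd Y.2
  have h0 : ∀ Y : Finset Γ.V, 0 ≤ Γ.cheegerOf Y := fun Y => by unfold cheegerOf; positivity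
  constructor
  · refine (ciInf_le ⟨0, ?_⟩ ⟨Y, hY⟩).trans_lt (by linarith [hsum ⟨Y, hY⟩])
    rintro _ ⟨Y, rfl⟩
    exact h0 Y
  · refine hc.trans_le (le_ciSup (f := fun Y : {Y : Finset Γ.V // Y.Nonempty} => Γ.densityOf Y.1)
      ⟨d, ?_⟩ ⟨Y, hY⟩)
    rintro _ ⟨Y, rfl⟩
    linarith [hsum Y, h0 Y.1]

end SerreGraph

/-! ### Degrees and densities in Cayley graphs. -/

section CayleyDegrees

variable {G : Type u} [Group G]

theorem Letter.natCard {G : Type u} (A : Finset G) :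
    Nat.card (Letter (A : Set G)) = 2 * A.card := by
  simp [Letter, mul_comm]

theorem leftCayleyGraph_ncard_src_tgt (A : Set G) (P : G → Prop) (w : G) :
    {e | (leftCayleyGraph A).src e = w ∧ P ((leftCayleyGraph A).tgt e)}.ncard =
      {l : Letter A | P (l.val⁻¹ * w)}.ncard := by
  refine Set.ncard_congr (fun e _ => e.1) ?_ ?_ ?_
  · rintro ⟨l, g⟩ ⟨rfl, h⟩
    change P (l.val⁻¹ * (l.val * g))
    rwa [inv_mul_cancel_left]
  · rintro ⟨l, g⟩ ⟨l', g'⟩ ⟨h, -⟩ ⟨h', -⟩ (rfl : l = l')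
    exact Prod.ext rfl (mul_left_cancel (G := G) (a := l.val) (h.trans h'.symm))
  · intro l h
    exact ⟨(l, (l.val⁻¹ * w : G)), ⟨mul_inv_cancel_left l.val w, h⟩, rfl⟩

theorem rightCayleyGraph_ncard_src_tgt (A : Set G) (P : G → Prop) (w : G) :
    {e | (rightCayleyGraph A).src e = w ∧ P ((rightCayleyGraph A).tgt e)}.ncard =
      {l : Letter A | P (w * l.val)}.ncard := by
  refine Set.ncard_congr (fun e _ => e.2) ?_ ?_ ?_
  · rintro ⟨g, l⟩ ⟨rfl, h⟩
    exact h
  · rintro ⟨g, l⟩ ⟨g', l'⟩ ⟨h, -⟩ ⟨h', -⟩ (rfl : l = l')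
    exact Prod.ext (h.trans h'.symm) rfl
  · intro l h
    exact ⟨(w, l), ⟨rfl, h⟩, rfl⟩

theorem leftCayleyGraph_ncard_src (A : Finset G) (w : G) :
    {e | (leftCayleyGraph (A : Set G)).src e = w}.ncard = 2 * A.card := by
  have := leftCayleyGraph_ncard_src_tgt (A : Set G) (fun _ => True) w
  simpa only [and_true, Set.ofPred_true, Set.ncard_univ, Letter.natCard] using this

theorem rightCayleyGraph_ncard_src (A : Finset G) (w : G) :
    {e | (rightCayleyGraph (A : Set G)).src e = w}.ncard = 2 * A.card := by
  have := rightCayleyGraph_ncard_src_tgt (A : Set G) (fun _ => True) w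
  simpa only [and_true, Set.ofPred_true, Set.ncard_univ, Letter.natCard] using this

theorem leftCayleyGraph_densityOf (A : Set G) (Y : Finset G) :
    (leftCayleyGraph A).densityOf Y =
      (∑ w ∈ Y, ({l : Letter A | l.val⁻¹ * w ∈ Y}.ncard : ℝ)) / (Y.card : ℝ) :=
  congrArg (· / (Y.card : ℝ)) (Finset.sum_congr rfl fun w _ =>
    congrArg Nat.cast (leftCayleyGraph_ncard_src_tgt A (· ∈ Y) w))

theorem rightCayleyGraph_densityOf (A : Set G) (Y : Finset G) :
    (rightCayleyGraph A).densityOf Y =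
      (∑ w ∈ Y, ({l : Letter A | w * l.val ∈ Y}.ncard : ℝ)) / (Y.card : ℝ) :=
  congrArg (· / (Y.card : ℝ)) (Finset.sum_congr rfl fun w _ =>
    congrArg Nat.cast (rightCayleyGraph_ncard_src_tgt A (· ∈ Y) w))

/-- Inversion carries the left Cayley graph to the right one. -/
theorem rightCayleyGraph_densityOf_of_eq_map_inv (A : Set G) {Y Y' : Finset G}
    (h : Y' = Y.map (Equiv.inv G).toEmbedding) :
    (rightCayleyGraph A).densityOf Y' = (leftCayleyGraph A).densityOf Y := by
  refine (rightCayleyGraph_densityOf A _).trans (Eq.trans ?_ (leftCayleyGraph_densityOf A Y).symm)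
  rw [h, Finset.card_map, Finset.sum_map]
  refine congrArg (· / (Y.card : ℝ)) (Finset.sum_congr rfl fun w _ => congrArg Nat.cast ?_)
  congr 1
  ext l
  rw [Set.mem_ofPred_eq, Set.mem_ofPred_eq, Finset.mem_map_equiv]
  simp

/-- Each edge of the left Cayley graph inside `Y` is counted at both ends. -/
theorem sum_ncard_letter_inv_mul_mem [DecidableEq G] (A Y : Finset G) :
    ∑ w ∈ Y, {l : Letter (A : Set G) | l.val⁻¹ * w ∈ Y}.ncard =
      2 * ∑ a ∈ A, (Y.filter fun g => a * g ∈ Y).card := by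
  have hdeg : ∀ w, {l : Letter (A : Set G) | l.val⁻¹ * w ∈ Y}.ncard =
      ∑ a ∈ A, ((if a⁻¹ * w ∈ Y then 1 else 0) + (if a * w ∈ Y then 1 else 0)) := by
    intro w
    rw [Set.ncard_eq_toFinset_card', Set.toFinset_ofPred,
      Finset.card_filter, Fintype.sum_prod_type, ← Finset.sum_coe_sort A]
    refine Finset.sum_congr rfl fun a _ => ?_
    rw [Fintype.sum_bool]
    simp [Letter.val]
  have hflip : ∀ a : G, (Y.filter fun g => a⁻¹ * g ∈ Y).card =
      (Y.filter fun g => a * g ∈ Y).card := by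
    intro a
    refine Finset.card_bij' (fun g _ => a⁻¹ * g) (fun g _ => a * g) ?_ ?_ ?_ ?_ <;>
      simp +contextual
  simp_rw [hdeg]
  rw [Finset.sum_comm, Finset.mul_sum]
  refine Finset.sum_congr rfl fun a _ => ?_
  rw [Finset.sum_add_distrib, ← Finset.card_filter, ← Finset.card_filter, hflip, two_mul]

end CayleyDegrees

noncomputable section

namespace ThompsonF

open BinaryTree

theorem x_mul_x {i j : ℕ} (h : i < j) : x j * x i = x i * x (j + 1) := by
  have h := PresentedGroup.one_of_mem (rels := thompsonRels) ⟨i, j, h, rfl⟩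
  rw [map_mul, map_inv, mul_inv_eq_one, map_mul, map_mul] at h
  exact h

/-! ### The action on the real line -/

/-- The homeomorphism of the line that is the identity on `(-∞, a]`, maps `[a, a + 2]` affinely
onto `[a, a + 1]`, and is the translation by `-1` on `[a + 2, ∞)`. -/
def contract (a : ℝ) : Equiv.Perm ℝ where
  toFun t := if t ≤ a then t else if t ≤ a + 2 then (t + a) / 2 else t - 1
  invFun t := if t ≤ a then t else if t ≤ a + 1 then 2 * t - a else t + 1
  left_inv t := by dsimp only; split_ifs <;> linarith
  right_inv t := by dsimp only; split_ifs <;> linarith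

theorem contract_apply (a t : ℝ) :
    contract a t = if t ≤ a then t else if t ≤ a + 2 then (t + a) / 2 else t - 1 := rfl

/-- Where `contract (b + 1)` is not the identity, `contract a` is translation by `-1`, which
conjugates it to `contract b`. -/
theorem contract_mul_contract {a b : ℝ} (h : a + 1 ≤ b) :
    contract b * contract a = contract a * contract (b + 1) := by
  ext t
  simp only [Equiv.Perm.mul_apply, contract_apply]
  split_ifs <;> linarith

/-- The action of `F` on the line by piecewise linear homeomorphisms. -/
def toPerm : ThompsonF →* Equiv.Perm ℝ :=
  PresentedGroup.toGroup (f := fun n : ℕ => contract n) <| by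
    rintro _ ⟨i, j, h, rfl⟩
    rw [map_mul, map_inv, mul_inv_eq_one]
    simp only [map_mul, FreeGroup.lift_apply_of]
    rw [contract_mul_contract (by exact_mod_cast h)]
    push_cast
    rfl

theorem toPerm_x (n : ℕ) : toPerm (x n) = contract n := PresentedGroup.toGroup.of _

/-- For `m < n` the point `m + 1` is fixed by `x n` and moved by `x m`. This makes the Cayley graph
6-regular. -/
theorem x_injective : Function.Injective x := by
  have key : ∀ m n : ℕ, m < n → x m ≠ x n := by
    intro m n h h'
    have h1 := congrArg (fun g => toPerm g ((m : ℝ) + 1)) h'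
    have : (m : ℝ) + 1 ≤ n := by exact_mod_cast h
    simp only [toPerm_x, contract_apply] at h1
    split_ifs at h1 <;> linarith
  intro m n h
  by_contra hne
  rcases lt_or_gt_of_ne hne with h' | h'
  · exact key _ _ h' h
  · exact key _ _ h' h.symm

/-! ### Elements of `F` given by forests -/

/-- The positive element that hangs the tree at position `i`. -/
def ofTree : ℕ → BinaryTree Unit → ThompsonF
  | _, nil => 1
  | i, node _ l r => x i * ofTree (i + 1) r * ofTree i l

/-- The positive element that hangs the trees of the list at the positions `i`, `i + 1`, …. -/
def ofForest : ℕ → List (BinaryTree Unit) → ThompsonF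
  | _, [] => 1
  | i, T :: Ts => ofForest (i + 1) Ts * ofTree i T

theorem x_mul_ofTree {i j : ℕ} (T : BinaryTree Unit) (h : j < i) :
    x j * ofTree (i + 1) T = ofTree i T * x j := by
  induction T generalizing i with
  | nil => simp [ofTree]
  | node _ l r ihl ihr =>
    simp only [ofTree]
    rw [← mul_assoc, ← mul_assoc, ← x_mul_x h, mul_assoc (x i), ihr (Nat.lt_succ_of_lt h),
      ← mul_assoc, mul_assoc _ (x j), ihl h]
    simp only [mul_assoc]

theorem x_mul_ofForest {i j : ℕ} (Ts : List (BinaryTree Unit)) (h : j < i) :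
    x j * ofForest (i + 1) Ts = ofForest i Ts * x j := by
  induction Ts generalizing i with
  | nil => simp [ofForest]
  | cons T Ts ih =>
    simp only [ofForest]
    rw [← mul_assoc, ih (Nat.lt_succ_of_lt h), mul_assoc, x_mul_ofTree T h, mul_assoc]

/-- Left multiplication by `x i` joins the trees at the positions `i` and `i + 1` by a caret. -/
theorem x_mul_ofForest_cons_cons (i : ℕ) (l r : BinaryTree Unit) (Ts : List (BinaryTree Unit)) :
    x i * ofForest i (l :: r :: Ts) = ofForest i (node () l r :: Ts) := by
  simp only [ofForest, ofTree]
  rw [← mul_assoc, ← mul_assoc, x_mul_ofForest Ts i.lt_add_one]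
  simp only [mul_assoc]

/-- The number of leaves of a forest. -/
def leaves (Ts : List (BinaryTree Unit)) : ℕ := (Ts.map numLeaves).sum

@[simp] theorem leaves_nil : leaves [] = 0 := rfl

@[simp] theorem leaves_cons (T : BinaryTree Unit) (Ts : List (BinaryTree Unit)) :
    leaves (T :: Ts) = T.numLeaves + leaves Ts := by
  simp [leaves]

/-- The elements that act by monotone maps `f` with `f t ≤ t` everywhere and `f t = t` on
`(-∞, a]`. -/
def contracting (a : ℝ) : Submonoid ThompsonF where
  carrier := {g | Monotone (toPerm g) ∧ (∀ t, toPerm g t ≤ t) ∧ ∀ t ≤ a, toPerm g t = t}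
  one_mem' := by simpa using monotone_id
  mul_mem' := by
    rintro g h ⟨h1, h2, h3⟩ ⟨h4, h5, h6⟩
    refine ⟨?_, fun t => ?_, fun t ht => ?_⟩
    · rw [map_mul]
      exact h1.comp h4
    · rw [map_mul]
      exact (h2 _).trans (h5 t)
    · rw [map_mul, Equiv.Perm.mul_apply, h6 t ht, h3 t ht]

theorem x_mem_contracting {a : ℝ} {i : ℕ} (h : a ≤ i) : x i ∈ contracting a := by
  refine ⟨fun s t hst => ?_, fun t => ?_, fun t ht => ?_⟩ <;>
    simp only [toPerm_x, contract_apply] <;> split_ifs <;> linarith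

theorem ofTree_mem_contracting {a : ℝ} {i : ℕ} (T : BinaryTree Unit) (h : a ≤ i) :
    ofTree i T ∈ contracting a := by
  induction T generalizing i with
  | nil => exact one_mem _
  | node _ l r ihl ihr =>
    exact mul_mem (mul_mem (x_mem_contracting h) (ihr (by push_cast; linarith))) (ihl h)

theorem ofForest_mem_contracting {a : ℝ} {i : ℕ} (Ts : List (BinaryTree Unit)) (h : a ≤ i) :
    ofForest i Ts ∈ contracting a := by
  induction Ts generalizing i with
  | nil => exact one_mem _
  | cons T Ts ih =>
    exact mul_mem (ih (by push_cast; linarith)) (ofTree_mem_contracting T h)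

/-- The point `i + 1` separates the two: it is fixed on the left, where only positions from `i + 1`
on are used, but on the right the last factor applied, `x i`, brings it to `i + 1/2` or below. -/
theorem ofForest_nil_cons_ne (i : ℕ) (l r : BinaryTree Unit) (Ts Ts' : List (BinaryTree Unit)) :
    ofForest i (nil :: Ts) ≠ ofForest i (node () l r :: Ts') := by
  intro h
  rw [← x_mul_ofForest_cons_cons] at h
  have h1 := congrArg (fun g => toPerm g ((i : ℝ) + 1)) h
  simp only [ofForest, ofTree, mul_one] at h1
  rw [(ofForest_mem_contracting (a := (i : ℝ) + 1) Ts (by simp)).2.2 _ le_rfl, map_mul,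
    Equiv.Perm.mul_apply] at h1
  have h2 := (ofForest_mem_contracting (a := (i : ℝ)) (l :: r :: Ts') le_rfl).2.1 (i + 1)
  have h3 := (x_mem_contracting (le_refl (i : ℝ))).1 h2
  simp only [ofForest] at h3
  have h4 : toPerm (x i) ((i : ℝ) + 1) = i + 1 / 2 := by
    rw [toPerm_x, contract_apply, if_neg (by linarith), if_pos (by linarith)]
    ring
  linarith

/-- Peel off the first tree, or cancel `x i` if both first trees have a root caret. Trailing trivial
trees do not change the element, hence the hypothesis on leaves. -/
theorem ofForest_injective {i : ℕ} {Ts Ts' : List (BinaryTree Unit)}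
    (hn : leaves Ts = leaves Ts') (h : ofForest i Ts = ofForest i Ts') : Ts = Ts' := by
  match Ts, Ts' with
  | [], [] => rfl
  | [], T :: Ts => have := T.numLeaves_pos; simp at hn; omega
  | T :: Ts, [] => have := T.numLeaves_pos; simp at hn; omega
  | nil :: Ts, nil :: Ts' =>
    have := ofForest_injective (i := i + 1) (Ts := Ts) (Ts' := Ts') (by simpa using hn)
      (by simpa [ofForest, ofTree] using h)
    rw [this]
  | nil :: Ts, node _ l r :: Ts' => exact (ofForest_nil_cons_ne _ _ _ _ _ h).elim
  | node _ l r :: Ts, nil :: Ts' => exact (ofForest_nil_cons_ne _ _ _ _ _ h.symm).elim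
  | node _ l r :: Ts, node _ l' r' :: Ts' =>
    rw [← x_mul_ofForest_cons_cons, ← x_mul_ofForest_cons_cons] at h
    have := ofForest_injective (Ts := l :: r :: Ts) (Ts' := l' :: r' :: Ts')
      (by simpa [add_assoc] using hn) (mul_left_cancel h)
    simp only [List.cons.injEq] at this
    obtain ⟨rfl, rfl, rfl⟩ := this
    rfl
-- Removing a root caret loses one node but lengthens the list by one, hence the factor `2`.
termination_by 2 * (Ts.map numNodes).sum + Ts.length
decreasing_by all_goals simp only [List.map_cons, List.sum_cons, List.length_cons, numNodes]; omega

/-! ### Forests with a marker -/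

/-- A forest with a marker: the trees to the left of the marker, from right to left, and the trees
to the right of the marker, from left to right. -/
abbrev MarkedForest : Type := List (BinaryTree Unit) × List (BinaryTree Unit)

namespace MarkedForest

/-- The tree whose left spine carries the given trees. -/
def spine : List (BinaryTree Unit) → BinaryTree Unit
  | [] => nil
  | T :: Ts => node () (spine Ts) T

theorem spine_injective : Function.Injective spine := by
  intro Ts Ts' h
  induction Ts generalizing Ts' with
  | nil => cases Ts' with
    | nil => rfl
    | cons => simp [spine] at h
  | cons T Ts ih => cases Ts' with
    | nil => simp [spine] at h
    | cons T' Ts' =>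
      simp only [spine, node.injEq, true_and] at h
      rw [ih h.1, h.2]

theorem numLeaves_spine (Ts : List (BinaryTree Unit)) :
    (spine Ts).numLeaves = leaves Ts + 1 := by
  induction Ts with
  | nil => rfl
  | cons T Ts ih => simp [spine, ih]; ring

/-- The element of `F` given by a marked forest. -/
def val (w : MarkedForest) : ThompsonF := ofForest 0 (spine w.1 :: w.2)

/-- The number of leaves of a marked forest. -/
def size (w : MarkedForest) : ℕ := leaves w.1 + leaves w.2

theorem val_injOn (n : ℕ) : Set.InjOn val {w | size w = n} := by
  intro w hw w' hw' h
  simp only [Set.mem_ofPred_eq, size] at hw hw'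
  have := ofForest_injective (by simp only [leaves_cons, numLeaves_spine]; omega) h
  rw [List.cons.injEq] at this
  exact Prod.ext (spine_injective this.1) this.2

/-- The marker jumps over the tree to its right. -/
def shift : MarkedForest → MarkedForest
  | (L, T :: R) => (T :: L, R)
  | w => w

/-- The first two trees to the right of the marker are joined by a caret. -/
def joinFst : MarkedForest → MarkedForest
  | (L, l :: r :: R) => (L, node () l r :: R)
  | w => w

/-- The second and the third tree to the right of the marker are joined by a caret. -/
def joinSnd : MarkedForest → MarkedForest
  | (L, T :: l :: r :: R) => (L, T :: node () l r :: R)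
  | w => w

theorem x_zero_mul_val (T : BinaryTree Unit) (L R : List (BinaryTree Unit)) :
    x 0 * val (L, T :: R) = val (shift (L, T :: R)) :=
  x_mul_ofForest_cons_cons 0 _ _ _

theorem x_one_mul_val (l r : BinaryTree Unit) (L R : List (BinaryTree Unit)) :
    x 1 * val (L, l :: r :: R) = val (joinFst (L, l :: r :: R)) := by
  simp only [val, joinFst]
  rw [ofForest, ← mul_assoc, x_mul_ofForest_cons_cons, ← ofForest]

theorem x_two_mul_val (T l r : BinaryTree Unit) (L R : List (BinaryTree Unit)) :
    x 2 * val (L, T :: l :: r :: R) = val (joinSnd (L, T :: l :: r :: R)) := by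
  simp only [val, joinSnd]
  rw [ofForest, ofForest, ← mul_assoc, ← mul_assoc, x_mul_ofForest_cons_cons, ← ofForest,
    ← ofForest]

theorem size_shift (w : MarkedForest) : size (shift w) = size w := by
  match w with
  | (L, []) => rfl
  | (L, T :: R) => simp [shift, size]; ring

theorem size_joinFst (w : MarkedForest) : size (joinFst w) = size w := by
  match w with
  | (L, []) => rfl
  | (L, [T]) => rfl
  | (L, l :: r :: R) => simp [joinFst, size, add_assoc]

theorem size_joinSnd (w : MarkedForest) : size (joinSnd w) = size w := by
  match w with
  | (L, []) => rfl
  | (L, [T]) => rfl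
  | (L, [T, T']) => rfl
  | (L, T :: l :: r :: R) => simp [joinSnd, size, add_assoc]

end MarkedForest

end ThompsonF

end

noncomputable section

namespace ThompsonF

open BinaryTree Finset

/-! ### Families of trees and forests, and their generating functions -/

/-- The trees of height at most `k`. -/
def trees : ℕ → Finset (BinaryTree Unit)
  | 0 => {nil}
  | k + 1 => insert nil ((trees k ×ˢ trees k).image fun p => node () p.1 p.2)

theorem nil_mem_trees (k : ℕ) : nil ∈ trees k := by
  cases k <;> simp [trees]

theorem node_mem_trees_succ {k : ℕ} {l r : BinaryTree Unit} :
    node () l r ∈ trees (k + 1) ↔ l ∈ trees k ∧ r ∈ trees k := by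
  simp [trees]

theorem trees_subset_succ (k : ℕ) : trees k ⊆ trees (k + 1) := by
  induction k with
  | zero => simp [trees]
  | succ k ih =>
    intro T hT
    cases T with
    | nil => exact nil_mem_trees _
    | node _ l r =>
      rw [node_mem_trees_succ] at hT ⊢
      exact ⟨ih hT.1, ih hT.2⟩

/-- The sum of `t ^ (number of leaves)` over a family of trees. -/
def weight (t : ℝ) (s : Finset (BinaryTree Unit)) : ℝ := ∑ T ∈ s, t ^ T.numLeaves

theorem weight_trees_succ (t : ℝ) (k : ℕ) :
    weight t (trees (k + 1)) = t + weight t (trees k) ^ 2 := by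
  rw [weight, trees, sum_insert (by simp), sum_image (by rintro ⟨_, _⟩ - ⟨_, _⟩ - h; simpa using h),
    sum_product, sq, weight, sum_mul_sum]
  simp [pow_add]

/-- In the recursion `p ↦ t + p ^ 2` the value `1/2` is a fixed point for `t = 1/4` and is never
exceeded, while for `t = 1/4 + η` every step adds at least `η`, because `(p - 1/2) ^ 2 ≥ 0`. The
intermediate value theorem applies in between. -/
theorem exists_weight_trees_eq_one {η : ℝ} (hη : 0 < η) :
    ∃ k, ∃ t, 1 / 4 ≤ t ∧ t ≤ 1 / 4 + η ∧ weight t (trees (k + 1)) = 1 := by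
  have hlow : ∀ k, 0 ≤ weight (1 / 4) (trees k) ∧ weight (1 / 4) (trees k) ≤ 1 / 2 := by
    intro k
    induction k with
    | zero => norm_num [trees, weight]
    | succ k ih => rw [weight_trees_succ]; constructor <;> nlinarith
  have hhigh : ∀ k : ℕ, k * η ≤ weight (1 / 4 + η) (trees k) := by
    intro k
    induction k with
    | zero => simp [trees, weight]; positivity
    | succ k ih =>
      rw [weight_trees_succ]
      push_cast
      nlinarith [sq_nonneg (weight (1 / 4 + η) (trees k) - 1 / 2)]
  obtain ⟨k, hk⟩ := exists_nat_ge (1 / η)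
  have hcont : Continuous fun t => weight t (trees (k + 1)) := by
    unfold weight
    fun_prop
  have h1 : 1 ≤ weight (1 / 4 + η) (trees (k + 1)) := by
    refine le_trans ?_ (hhigh (k + 1))
    rw [div_le_iff₀ hη] at hk
    push_cast
    linarith
  obtain ⟨t, ht, h⟩ := intermediate_value_Icc (le_add_of_nonneg_right (a := (1 / 4 : ℝ)) hη.le)
    hcont.continuousOn (show (1 : ℝ) ∈ Set.Icc _ _ from ⟨by linarith [(hlow (k + 1)).2], h1⟩)
  exact ⟨k, t, ht.1, ht.2, h⟩

/-- The forests whose trees belong to the given families. -/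
def forests : List (Finset (BinaryTree Unit)) → Finset (List (BinaryTree Unit))
  | [] => {[]}
  | s :: ss => (s ×ˢ forests ss).image fun p => p.1 :: p.2

theorem sum_forests (t : ℝ) (ss : List (Finset (BinaryTree Unit))) :
    ∑ Ts ∈ forests ss, t ^ leaves Ts = (ss.map (weight t)).prod := by
  induction ss with
  | nil => simp [forests]
  | cons s ss ih =>
    rw [forests, sum_image (by rintro ⟨_, _⟩ - ⟨_, _⟩ - h; simpa using h), sum_product,
      List.map_cons, List.prod_cons, ← ih, weight, sum_mul_sum]
    simp [pow_add]

/-- The first trees of the forest belong to the given families, the others belong to `S`. -/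
def StartsIn (S : Finset (BinaryTree Unit)) :
    List (Finset (BinaryTree Unit)) → List (BinaryTree Unit) → Prop
  | [], Ts => ∀ T ∈ Ts, T ∈ S
  | _ :: _, [] => False
  | s :: ss, T :: Ts => T ∈ s ∧ StartsIn S ss Ts

theorem mem_forests_append_replicate {S : Finset (BinaryTree Unit)}
    {ss : List (Finset (BinaryTree Unit))} {m : ℕ} {Ts : List (BinaryTree Unit)} :
    Ts ∈ forests (ss ++ List.replicate m S) ↔ StartsIn S ss Ts ∧ Ts.length = ss.length + m := by
  induction ss generalizing Ts with
  | nil =>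
    induction m generalizing Ts with
    | zero => cases Ts <;> simp [forests, StartsIn]
    | succ m ih =>
      simp only [List.nil_append, StartsIn, List.length_nil, zero_add] at ih ⊢
      cases Ts <;> simp [forests, List.replicate_succ, ih, and_assoc]
  | cons s ss ih =>
    cases Ts with
    | nil => simp [forests, StartsIn]
    | cons T Ts =>
      simp only [List.cons_append, forests, mem_image, mem_product, Prod.exists, List.cons.injEq,
        StartsIn, List.length_cons, add_right_comm _ 1 m, Nat.add_right_cancel_iff, ih]
      constructor
      · rintro ⟨_, _, h, rfl, rfl⟩
        exact ⟨⟨h.1, h.2.1⟩, h.2.2⟩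
      · rintro h
        exact ⟨_, _, ⟨h.1.1, h.1.2, h.2⟩, rfl, rfl⟩

/-- The pairs of natural numbers with sum at most `K`. -/
def triangle (K : ℕ) : Finset (ℕ × ℕ) := (range (K + 1)).biUnion antidiagonal

theorem mem_triangle {K : ℕ} {p : ℕ × ℕ} : p ∈ triangle K ↔ p.1 + p.2 ≤ K := by
  simp [triangle]

theorem card_triangle (K : ℕ) : ((triangle K).card : ℝ) = (K + 1) * (K + 2) / 2 := by
  rw [triangle, card_biUnion]
  · induction K with
    | zero => simp
    | succ K ih =>
      rw [sum_range_succ, Nat.cast_add, ih, Nat.card_antidiagonal]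
      push_cast
      ring
  · intro i _ j _ h
    exact disjoint_left.2 fun p hp hp' =>
      h ((mem_antidiagonal.1 hp).symm.trans (mem_antidiagonal.1 hp'))

namespace MarkedForest

/-- The marked forests that start with trees from the given families to the left and to the right
of the marker, with at most `K` further trees, all in `S`. -/
def cylinder (S : Finset (BinaryTree Unit)) (ps qs : List (Finset (BinaryTree Unit))) (K : ℕ) :
    Finset MarkedForest :=
  (triangle K).biUnion fun p =>
    forests (ps ++ List.replicate p.1 S) ×ˢ forests (qs ++ List.replicate p.2 S)

theorem mem_cylinder {S : Finset (BinaryTree Unit)} {ps qs : List (Finset (BinaryTree Unit))}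
    {K : ℕ} {w : MarkedForest} : w ∈ cylinder S ps qs K ↔
      StartsIn S ps w.1 ∧ StartsIn S qs w.2 ∧
        w.1.length + w.2.length ≤ ps.length + qs.length + K := by
  have hlen : ∀ {ss : List (Finset (BinaryTree Unit))} {Ts : List (BinaryTree Unit)},
      StartsIn S ss Ts → ss.length ≤ Ts.length := by
    intro ss
    induction ss with
    | nil => simp
    | cons s ss ih =>
      rintro (_ | ⟨T, Ts⟩) h
      · exact h.elim
      · simpa using ih h.2
  simp only [cylinder, mem_biUnion, mem_triangle, mem_product, mem_forests_append_replicate]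
  constructor
  · rintro ⟨p, hp, ⟨h1, h2⟩, h3, h4⟩
    exact ⟨h1, h3, by omega⟩
  · rintro ⟨h1, h2, h3⟩
    have := hlen h1
    have := hlen h2
    exact ⟨(w.1.length - ps.length, w.2.length - qs.length), by dsimp only; omega,
      ⟨h1, by dsimp only; omega⟩, h2, by dsimp only; omega⟩

/-- The sum of `t ^ (number of leaves)` over a family of marked forests. -/
def mass (t : ℝ) (U : Finset MarkedForest) : ℝ := ∑ w ∈ U, t ^ size w

/-- Further trees range over a family of weight `1`, so each pair in the triangle contributes the
same mass. -/
theorem mass_cylinder {t : ℝ} {S : Finset (BinaryTree Unit)} (hS : weight t S = 1)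
    (ps qs : List (Finset (BinaryTree Unit))) (K : ℕ) :
    mass t (cylinder S ps qs K) =
      (ps.map (weight t)).prod * (qs.map (weight t)).prod * ((K + 1) * (K + 2) / 2) := by
  rw [mass, cylinder, sum_biUnion]
  · have : ∀ p ∈ triangle K, ∑ w ∈ forests (ps ++ List.replicate p.1 S) ×ˢ
        forests (qs ++ List.replicate p.2 S), t ^ size w =
        (ps.map (weight t)).prod * (qs.map (weight t)).prod := by
      intro p _
      rw [sum_product]
      simp only [size, pow_add]
      rw [← sum_mul_sum, sum_forests, sum_forests]
      simp [hS]
    rw [sum_congr rfl this, sum_const, nsmul_eq_mul, card_triangle, mul_comm]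
  · intro p _ q _ h
    refine disjoint_left.2 fun w hw hw' => h ?_
    simp only [mem_product, mem_forests_append_replicate] at hw hw'
    exact Prod.ext (by omega) (by omega)

/-! ### Comparison of masses. -/

section Mass

variable {t : ℝ} (ht : 0 < t)
include ht

theorem mass_mono {U V : Finset MarkedForest} (h : U ⊆ V) : mass t U ≤ mass t V :=
  sum_le_sum_of_subset_of_nonneg h fun _ _ _ => by positivity

theorem mass_nonneg (U : Finset MarkedForest) : 0 ≤ mass t U :=
  sum_nonneg fun _ _ => by positivity

theorem mass_union_le (U V : Finset MarkedForest) : mass t (U ∪ V) ≤ mass t U + mass t V := by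
  have : mass t (U ∪ V) + mass t (U ∩ V) = mass t U + mass t V := sum_union_inter
  linarith [mass_nonneg ht (U ∩ V)]

theorem mass_filter_map_mem_le {f : MarkedForest → MarkedForest} (hf : ∀ w, size (f w) = size w)
    {U : Finset MarkedForest} (hinj : Set.InjOn f U) (V : Finset MarkedForest) :
    mass t (U.filter fun w => f w ∈ V) ≤ mass t V := by
  have : mass t (U.filter fun w => f w ∈ V) = mass t ((U.filter fun w => f w ∈ V).image f) := by
    rw [mass, mass, sum_image (hinj.mono fun w hw => (mem_filter.1 hw).1)]
    simp only [hf]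
  rw [this]
  refine mass_mono ht (image_subset_iff.2 fun w hw => (mem_filter.1 hw).2)

end Mass

theorem mass_union {t : ℝ} {U V : Finset MarkedForest} (h : Disjoint U V) :
    mass t (U ∪ V) = mass t U + mass t V := sum_union h

theorem mass_filter_add_mass_filter_not (t : ℝ) (U : Finset MarkedForest)
    (P : MarkedForest → Prop) [DecidablePred P] :
    mass t (U.filter P) + mass t (U.filter fun w => ¬ P w) = mass t U :=
  sum_filter_add_sum_filter_not U P _

/-- If the mass of three families exceeds a multiple of the mass of another one, then the same
holds for the cardinalities of the subfamilies of forests with some given number of leaves. -/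
theorem exists_card_filter_size_lt {t c : ℝ} (ht : 0 < t) {Y U V W : Finset MarkedForest}
    (h : c * mass t Y < 2 * (mass t U + mass t V + mass t W)) :
    ∃ n, c * (Y.filter fun w => size w = n).card <
      2 * ((U.filter fun w => size w = n).card + (V.filter fun w => size w = n).card +
        (W.filter fun w => size w = n).card) := by
  -- Sorting by size writes each mass as a combination of cardinalities with the same coefficients
  -- `t ^ n`; if the inequality failed for every `n`, it would fail for the masses.
  have key : ∀ U' ⊆ Y ∪ U ∪ V ∪ W, mass t U' =
      ∑ n ∈ (Y ∪ U ∪ V ∪ W).image size, (U'.filter fun w => size w = n).card * t ^ n := by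
    intro U' hU'
    rw [mass, ← sum_fiberwise_of_maps_to (g := size) fun w hw => mem_image_of_mem _ (hU' hw)]
    refine sum_congr rfl fun n _ => ?_
    rw [← nsmul_eq_mul, ← sum_const]
    exact sum_congr rfl fun w hw => by rw [(mem_filter.1 hw).2]
  by_contra! hcon
  refine h.not_ge ?_
  rw [key Y (by intro; simp +contextual), key U (by intro; simp +contextual),
    key V (by intro; simp +contextual), key W (by intro; simp +contextual), ← sum_add_distrib,
    ← sum_add_distrib, mul_sum, mul_sum]
  refine sum_le_sum fun n _ => ?_
  have := mul_le_mul_of_nonneg_right (hcon n) (pow_nonneg ht.le n)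
  linarith

end MarkedForest

end ThompsonF

end

noncomputable section

namespace ThompsonF

open BinaryTree Finset

namespace MarkedForest

/-! ### The dense families of marked forests -/

section Alternating

variable (S S' : Finset (BinaryTree Unit)) (K : ℕ)

/-- The marked forests in which the trees around the marker are alternately trivial and in
`S \ S'`, where the pattern of length four starts at `0`, `1` or `2` trees to the left of the
marker. -/
def alternating : Fin 3 → Finset MarkedForest
  | 0 => cylinder S [] [{nil}, S \ S', {nil}, S \ S'] K
  | 1 => cylinder S [{nil}] [S \ S', {nil}, S \ S'] K
  | 2 => cylinder S [S \ S', {nil}] [{nil}, S \ S'] K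

/-- All positions of the marker in an alternating pattern. -/
def poor : Finset MarkedForest :=
  alternating S S' K 1 ∪ (alternating S S' K 0 ∪ alternating S S' K 2)

/-- All marked forests with at most `K + 4` trees, except for the alternating ones. -/
def rich : Finset MarkedForest := cylinder S [] [] (K + 4) \ poor S S' K

/-- The edges labelled `x 0` between rich marked forests. -/
def shiftable : Finset MarkedForest := (cylinder S [] [S] (K + 3)).filter fun w =>
  ¬(w ∈ poor S S' K ∨ shift w ∈ poor S S' K)

/-- Edges labelled `x 1` between rich marked forests. -/
def fstJoinable : Finset MarkedForest := (cylinder S [] [S', S'] (K + 2)).filter fun w =>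
  joinFst w ∉ poor S S' K

/-- Edges labelled `x 2` between rich marked forests. -/
def sndJoinable : Finset MarkedForest := (cylinder S [] [S, S', S'] (K + 1)).filter fun w =>
  joinSnd w ∉ poor S S' K

variable {S S' K}

theorem startsIn_cons {s : Finset (BinaryTree Unit)} {ss : List (Finset (BinaryTree Unit))}
    {Ts : List (BinaryTree Unit)} :
    StartsIn S (s :: ss) Ts ↔ ∃ T Ts', Ts = T :: Ts' ∧ T ∈ s ∧ StartsIn S ss Ts' := by
  cases Ts <;> simp [StartsIn]

theorem mem_cylinder_nil_nil {w : MarkedForest} : w ∈ cylinder S [] [] K ↔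
    (∀ T ∈ w.1, T ∈ S) ∧ (∀ T ∈ w.2, T ∈ S) ∧ w.1.length + w.2.length ≤ K := by
  simp [mem_cylinder, StartsIn]

theorem mem_alternating_zero {w : MarkedForest} : w ∈ alternating S S' K 0 ↔
    ∃ L T U R, w = (L, nil :: T :: nil :: U :: R) ∧ T ∈ S \ S' ∧ U ∈ S \ S' ∧
      (L, R) ∈ cylinder S [] [] K := by
  simp only [alternating, mem_cylinder, startsIn_cons, StartsIn, mem_singleton]
  constructor
  · rintro ⟨hL, ⟨_, _, h1, rfl, T, _, rfl, hT, _, _, rfl, rfl, U, R, rfl, hU, hR⟩, hlen⟩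
    exact ⟨w.1, T, U, R, Prod.ext rfl h1, hT, hU, hL, hR, by simp [h1] at hlen ⊢; omega⟩
  · rintro ⟨L, T, U, R, rfl, hT, hU, hL, hR, hlen⟩
    exact ⟨hL, ⟨_, _, rfl, rfl, _, _, rfl, hT, _, _, rfl, rfl, _, _, rfl, hU, hR⟩,
      by simp at hlen ⊢; omega⟩

theorem mem_alternating_one {w : MarkedForest} : w ∈ alternating S S' K 1 ↔
    ∃ L T U R, w = (nil :: L, T :: nil :: U :: R) ∧ T ∈ S \ S' ∧ U ∈ S \ S' ∧
      (L, R) ∈ cylinder S [] [] K := by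
  simp only [alternating, mem_cylinder, startsIn_cons, StartsIn, mem_singleton]
  constructor
  · rintro ⟨⟨_, L, h2, rfl, hL⟩, ⟨T, _, h1, hT, _, _, rfl, rfl, U, R, rfl, hU, hR⟩, hlen⟩
    exact ⟨L, T, U, R, Prod.ext h2 h1, hT, hU, hL, hR, by simp [h1, h2] at hlen ⊢; omega⟩
  · rintro ⟨L, T, U, R, rfl, hT, hU, hL, hR, hlen⟩
    exact ⟨⟨_, _, rfl, rfl, hL⟩, ⟨_, _, rfl, hT, _, _, rfl, rfl, _, _, rfl, hU, hR⟩,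
      by simp at hlen ⊢; omega⟩

theorem mem_alternating_two {w : MarkedForest} : w ∈ alternating S S' K 2 ↔
    ∃ L T U R, w = (T :: nil :: L, nil :: U :: R) ∧ T ∈ S \ S' ∧ U ∈ S \ S' ∧
      (L, R) ∈ cylinder S [] [] K := by
  simp only [alternating, mem_cylinder, startsIn_cons, StartsIn, mem_singleton]
  constructor
  · rintro ⟨⟨T, _, h2, hT, _, L, rfl, rfl, hL⟩, ⟨_, _, h1, rfl, U, R, rfl, hU, hR⟩, hlen⟩
    exact ⟨L, T, U, R, Prod.ext h2 h1, hT, hU, hL, hR, by simp [h1, h2] at hlen ⊢; omega⟩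
  · rintro ⟨L, T, U, R, rfl, hT, hU, hL, hR, hlen⟩
    exact ⟨⟨_, _, rfl, hT, _, _, rfl, rfl, hL⟩, ⟨_, _, rfl, rfl, _, _, rfl, hU, hR⟩,
      by simp at hlen ⊢; omega⟩

theorem mem_cylinder_one {w : MarkedForest} : w ∈ cylinder S [] [S] K ↔
    ∃ L T R, w = (L, T :: R) ∧ T ∈ S ∧ (L, R) ∈ cylinder S [] [] K := by
  simp only [mem_cylinder, startsIn_cons, StartsIn]
  constructor
  · rintro ⟨hL, ⟨T, R, h1, hT, hR⟩, hlen⟩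
    exact ⟨w.1, T, R, Prod.ext rfl h1, hT, hL, hR, by simp [h1] at hlen ⊢; omega⟩
  · rintro ⟨L, T, R, rfl, hT, hL, hR, hlen⟩
    exact ⟨hL, ⟨_, _, rfl, hT, hR⟩, by simp at hlen ⊢; omega⟩

theorem exists_of_mem_cylinder_two {w : MarkedForest} (hw : w ∈ cylinder S [] [S', S'] K) :
    ∃ L l r R, w = (L, l :: r :: R) ∧ l ∈ S' ∧ r ∈ S' ∧ (L, R) ∈ cylinder S [] [] K := by
  simp only [mem_cylinder, startsIn_cons, StartsIn] at hw ⊢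
  obtain ⟨hL, ⟨l, _, h1, hl, r, R, rfl, hr, hR⟩, hlen⟩ := hw
  exact ⟨w.1, l, r, R, Prod.ext rfl h1, hl, hr, hL, hR, by simp [h1] at hlen ⊢; omega⟩

theorem exists_of_mem_cylinder_three {w : MarkedForest} (hw : w ∈ cylinder S [] [S, S', S'] K) :
    ∃ L T l r R, w = (L, T :: l :: r :: R) ∧ T ∈ S ∧ l ∈ S' ∧ r ∈ S' ∧
      (L, R) ∈ cylinder S [] [] K := by
  simp only [mem_cylinder, startsIn_cons, StartsIn] at hw ⊢
  obtain ⟨hL, ⟨T, _, h1, hT, l, _, rfl, hl, r, R, rfl, hr, hR⟩, hlen⟩ := hw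
  exact ⟨w.1, T, l, r, R, Prod.ext rfl h1, hT, hl, hr, hL, hR, by simp [h1] at hlen ⊢; omega⟩

theorem shift_mem_alternating_one {w : MarkedForest} (hw : w ∈ alternating S S' K 0) :
    shift w ∈ alternating S S' K 1 := by
  obtain ⟨L, T, U, R, rfl, h⟩ := mem_alternating_zero.1 hw
  exact mem_alternating_one.2 ⟨L, T, U, R, rfl, h⟩

theorem shift_mem_alternating_two {w : MarkedForest} (hw : w ∈ alternating S S' K 1) :
    shift w ∈ alternating S S' K 2 := by
  obtain ⟨L, T, U, R, rfl, h⟩ := mem_alternating_one.1 hw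
  exact mem_alternating_two.2 ⟨L, T, U, R, rfl, h⟩

theorem mem_poor {w : MarkedForest} : w ∈ poor S S' K ↔ w ∈ alternating S S' K 1 ∨
    w ∈ alternating S S' K 0 ∨ w ∈ alternating S S' K 2 := by
  simp [poor]

theorem alternating_subset_poor (i : Fin 3) : alternating S S' K i ⊆ poor S S' K := by
  intro w hw
  fin_cases i
  exacts [mem_poor.2 (.inr (.inl hw)), mem_poor.2 (.inl hw), mem_poor.2 (.inr (.inr hw))]

/-- The tree after the marker is nontrivial in position `1` and trivial in positions `0` and `2`.
The last two families may overlap. -/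
theorem disjoint_alternating (hnil : nil ∈ S') : Disjoint (alternating S S' K 1)
    (alternating S S' K 0 ∪ alternating S S' K 2) := by
  refine disjoint_left.2 fun w hw hw' => ?_
  obtain ⟨L, T, U, R, rfl, hT, -⟩ := mem_alternating_one.1 hw
  rw [mem_union, mem_alternating_zero, mem_alternating_two] at hw'
  rcases hw' with ⟨_, _, _, _, h, -⟩ | ⟨_, _, _, _, h, -⟩ <;>
  · simp only [Prod.mk.injEq, List.cons.injEq] at h
    rw [h.2.1] at hT
    exact (mem_sdiff.1 hT).2 hnil

/-- In each pattern one of the two trees after the marker lies outside `S'`, so no counted `x 1`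
edge starts at a poor forest. -/
theorem notMem_poor_of_mem_cylinder_two {w : MarkedForest} {N : ℕ}
    (hw : w ∈ cylinder S [] [S', S'] N) : w ∉ poor S S' K := by
  obtain ⟨L, l, r, R, rfl, hl, hr, -⟩ := exists_of_mem_cylinder_two hw
  rw [mem_poor, mem_alternating_zero, mem_alternating_one, mem_alternating_two]
  rintro (⟨_, T, U, _, h, hT, hU, -⟩ | ⟨_, T, U, _, h, hT, hU, -⟩ | ⟨_, T, U, _, h, hT, hU, -⟩) <;>
  · simp only [Prod.mk.injEq, List.cons.injEq] at h
    simp_all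

/-- The second or third tree after the marker lies outside `S'` in each pattern; for position `1`
this is the role of the last tree `U`. -/
theorem notMem_poor_of_mem_cylinder_three {w : MarkedForest} {N : ℕ}
    (hw : w ∈ cylinder S [] [S, S', S'] N) : w ∉ poor S S' K := by
  obtain ⟨L, T₀, l, r, R, rfl, -, hl, hr, -⟩ := exists_of_mem_cylinder_three hw
  rw [mem_poor, mem_alternating_zero, mem_alternating_one, mem_alternating_two]
  rintro (⟨_, T, U, _, h, hT, hU, -⟩ | ⟨_, T, U, _, h, hT, hU, -⟩ | ⟨_, T, U, _, h, hT, hU, -⟩) <;>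
  · simp only [Prod.mk.injEq, List.cons.injEq] at h
    simp_all

/-- The new caret makes the first tree nontrivial, which only position `1` allows. -/
theorem mem_alternating_of_joinFst_mem_poor {w : MarkedForest} {N : ℕ}
    (hw : w ∈ cylinder S [] [S', S'] N) (h : joinFst w ∈ poor S S' K) :
    joinFst w ∈ alternating S S' K 1 := by
  obtain ⟨L, l, r, R, rfl, -⟩ := exists_of_mem_cylinder_two hw
  rcases mem_poor.1 h with h | h | h
  · exact h
  · obtain ⟨_, _, _, _, h, -⟩ := mem_alternating_zero.1 h
    simp [joinFst] at h
  · obtain ⟨_, _, _, _, h, -⟩ := mem_alternating_two.1 h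
    simp [joinFst] at h

/-- The new caret makes the second tree nontrivial, which excludes position `1`. -/
theorem mem_alternating_of_joinSnd_mem_poor {w : MarkedForest} {N : ℕ}
    (hw : w ∈ cylinder S [] [S, S', S'] N) (h : joinSnd w ∈ poor S S' K) :
    joinSnd w ∈ alternating S S' K 0 ∪ alternating S S' K 2 := by
  obtain ⟨L, T, l, r, R, rfl, -⟩ := exists_of_mem_cylinder_three hw
  rcases mem_poor.1 h with h | h
  · obtain ⟨_, _, _, _, h, -⟩ := mem_alternating_one.1 h
    simp [joinSnd] at h
  · exact mem_union.2 h

theorem alternating_subset_cylinder (hnil : nil ∈ S) (i : Fin 3) :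
    alternating S S' K i ⊆ cylinder S [] [] (K + 4) := by
  intro w hw
  rw [mem_cylinder_nil_nil]
  fin_cases i
  · obtain ⟨L, T, U, R, rfl, hT, hU, h⟩ := mem_alternating_zero.1 hw
    rw [mem_cylinder_nil_nil] at h
    simp_all
    omega
  · obtain ⟨L, T, U, R, rfl, hT, hU, h⟩ := mem_alternating_one.1 hw
    rw [mem_cylinder_nil_nil] at h
    simp_all
    omega
  · obtain ⟨L, T, U, R, rfl, hT, hU, h⟩ := mem_alternating_two.1 hw
    rw [mem_cylinder_nil_nil] at h
    simp_all
    omega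

theorem poor_subset_cylinder (hnil : nil ∈ S) : poor S S' K ⊆ cylinder S [] [] (K + 4) :=
  union_subset (alternating_subset_cylinder hnil 1) (union_subset
    (alternating_subset_cylinder hnil 0) (alternating_subset_cylinder hnil 2))

theorem shift_mem_rich {w : MarkedForest} (hw : w ∈ shiftable S S' K) :
    w ∈ rich S S' K ∧ x 0 * val w = val (shift w) ∧ shift w ∈ rich S S' K := by
  rw [shiftable, mem_filter, not_or] at hw
  obtain ⟨h, h1, h2⟩ := hw
  obtain ⟨L, T, R, rfl, hT, h⟩ := mem_cylinder_one.1 h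
  rw [mem_cylinder_nil_nil] at h
  refine ⟨mem_sdiff.2 ⟨mem_cylinder_nil_nil.2 ?_, h1⟩, x_zero_mul_val _ _ _,
    mem_sdiff.2 ⟨mem_cylinder_nil_nil.2 ?_, h2⟩⟩ <;>
  · simp_all [shift]
    omega

theorem joinFst_mem_rich (hsub : S' ⊆ S) (hnode : ∀ l ∈ S', ∀ r ∈ S', node () l r ∈ S)
    {w : MarkedForest} (hw : w ∈ fstJoinable S S' K) :
    w ∈ rich S S' K ∧ x 1 * val w = val (joinFst w) ∧ joinFst w ∈ rich S S' K := by
  rw [fstJoinable, mem_filter] at hw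
  obtain ⟨h, h2⟩ := hw
  have h1 := notMem_poor_of_mem_cylinder_two (K := K) h
  obtain ⟨L, l, r, R, rfl, hl, hr, h⟩ := exists_of_mem_cylinder_two h
  rw [mem_cylinder_nil_nil] at h
  have := hsub hl
  have := hsub hr
  refine ⟨mem_sdiff.2 ⟨mem_cylinder_nil_nil.2 ?_, h1⟩, x_one_mul_val _ _ _ _,
    mem_sdiff.2 ⟨mem_cylinder_nil_nil.2 ?_, h2⟩⟩ <;>
  · simp_all [joinFst]
    omega

theorem joinSnd_mem_rich (hsub : S' ⊆ S) (hnode : ∀ l ∈ S', ∀ r ∈ S', node () l r ∈ S)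
    {w : MarkedForest} (hw : w ∈ sndJoinable S S' K) :
    w ∈ rich S S' K ∧ x 2 * val w = val (joinSnd w) ∧ joinSnd w ∈ rich S S' K := by
  rw [sndJoinable, mem_filter] at hw
  obtain ⟨h, h2⟩ := hw
  have h1 := notMem_poor_of_mem_cylinder_three (K := K) h
  obtain ⟨L, T, l, r, R, rfl, hT, hl, hr, h⟩ := exists_of_mem_cylinder_three h
  rw [mem_cylinder_nil_nil] at h
  have := hsub hl
  have := hsub hr
  refine ⟨mem_sdiff.2 ⟨mem_cylinder_nil_nil.2 ?_, h1⟩, x_two_mul_val _ _ _ _ _,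
    mem_sdiff.2 ⟨mem_cylinder_nil_nil.2 ?_, h2⟩⟩ <;>
  · simp_all [joinSnd]
    omega

theorem shift_injOn (N : ℕ) : Set.InjOn shift (cylinder S [] [S] N : Set MarkedForest) := by
  intro w hw w' hw' h
  obtain ⟨L, T, R, rfl, -⟩ := mem_cylinder_one.1 (mem_coe.1 hw)
  obtain ⟨L', T', R', rfl, -⟩ := mem_cylinder_one.1 (mem_coe.1 hw')
  simp_all [shift]

theorem joinFst_injOn (N : ℕ) :
    Set.InjOn joinFst (cylinder S [] [S', S'] N : Set MarkedForest) := by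
  intro w hw w' hw' h
  obtain ⟨L, l, r, R, rfl, -⟩ := exists_of_mem_cylinder_two (mem_coe.1 hw)
  obtain ⟨L', l', r', R', rfl, -⟩ := exists_of_mem_cylinder_two (mem_coe.1 hw')
  simp_all [joinFst]

theorem joinSnd_injOn (N : ℕ) :
    Set.InjOn joinSnd (cylinder S [] [S, S', S'] N : Set MarkedForest) := by
  intro w hw w' hw' h
  obtain ⟨L, T, l, r, R, rfl, -⟩ := exists_of_mem_cylinder_three (mem_coe.1 hw)
  obtain ⟨L', T', l', r', R', rfl, -⟩ := exists_of_mem_cylinder_three (mem_coe.1 hw')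
  simp_all [joinSnd]

/-! ### Mass of the edges that survive the deletion. -/

section MassBounds

variable {t : ℝ} (ht : 0 < t)
include ht

/-- By injectivity a lost edge is determined by its endpoint in `V'`. -/
theorem le_mass_filter_map_notMem {f : MarkedForest → MarkedForest}
    (hf : ∀ w, size (f w) = size w) {U V V' : Finset MarkedForest} (hinj : Set.InjOn f U)
    (hV : ∀ w ∈ U, f w ∈ V → f w ∈ V') :
    mass t U - mass t V' ≤ mass t (U.filter fun w => f w ∉ V) := by
  have h1 := mass_filter_add_mass_filter_not t U fun w => f w ∈ V
  have h2 := mass_filter_map_mem_le ht hf hinj V'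
  have h3 : mass t (U.filter fun w => f w ∈ V) ≤ mass t (U.filter fun w => f w ∈ V') :=
    mass_mono ht fun w hw => by
      rw [mem_filter] at hw ⊢
      exact ⟨hw.1, hV w hw.1 hw.2⟩
  linarith

theorem le_mass_fstJoinable : mass t (cylinder S [] [S', S'] (K + 2)) -
    mass t (alternating S S' K 1) ≤ mass t (fstJoinable S S' K) :=
  le_mass_filter_map_notMem ht size_joinFst (joinFst_injOn (S := S) _)
    fun _ hw => mem_alternating_of_joinFst_mem_poor hw

theorem le_mass_sndJoinable : mass t (cylinder S [] [S, S', S'] (K + 1)) -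
    mass t (alternating S S' K 0 ∪ alternating S S' K 2) ≤ mass t (sndJoinable S S' K) :=
  le_mass_filter_map_notMem ht size_joinSnd (joinSnd_injOn (S := S) _)
    fun _ hw => mem_alternating_of_joinSnd_mem_poor hw

/-- Inclusion-exclusion over the two ends of an edge: those starting in positions `0` and `1` have
both ends poor and are lost only once. -/
theorem le_mass_shiftable (hnil : nil ∈ S) : mass t (cylinder S [] [S] (K + 3)) +
    mass t (alternating S S' K 1 ∪ alternating S S' K 0) - 2 * mass t (poor S S' K) ≤
      mass t (shiftable S S' K) := by
  set A := cylinder S [] [S] (K + 3) with hA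
  have h1 := mass_filter_add_mass_filter_not t A
    fun w => w ∈ poor S S' K ∨ shift w ∈ poor S S' K
  have h2 : mass t (A.filter fun w => w ∈ poor S S' K ∨ shift w ∈ poor S S' K) +
      mass t (A.filter fun w => w ∈ poor S S' K ∧ shift w ∈ poor S S' K) =
      mass t (A.filter fun w => w ∈ poor S S' K) +
        mass t (A.filter fun w => shift w ∈ poor S S' K) := by
    rw [filter_or, filter_and]
    exact sum_union_inter
  have h3 := mass_filter_map_mem_le ht size_shift (shift_injOn (S := S) _) (poor S S' K) (U := A)
  have h4 : mass t (A.filter fun w => w ∈ poor S S' K) ≤ mass t (poor S S' K) :=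
    mass_mono ht fun w hw => (mem_filter.1 hw).2
  have hmem : ∀ i, ∀ w ∈ alternating S S' K i, w.2 ≠ [] → w ∈ A := by
    intro i w hw hne
    obtain ⟨hL, hR, hlen⟩ := mem_cylinder_nil_nil.1 (alternating_subset_cylinder hnil i hw)
    obtain ⟨L, R⟩ := w
    cases R with
    | nil => exact (hne rfl).elim
    | cons T R =>
      rw [List.forall_mem_cons] at hR
      refine mem_cylinder_one.2 ⟨L, T, R, rfl, hR.1, mem_cylinder_nil_nil.2 ⟨hL, hR.2, ?_⟩⟩
      simp only [List.length_cons] at hlen ⊢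
      omega
  have h5 : mass t (alternating S S' K 1 ∪ alternating S S' K 0) ≤
      mass t (A.filter fun w => w ∈ poor S S' K ∧ shift w ∈ poor S S' K) := by
    refine mass_mono ht (union_subset ?_ ?_) <;> intro w hw <;>
      refine mem_filter.2 ⟨hmem _ w hw ?_, alternating_subset_poor _ hw, ?_⟩
    · obtain ⟨_, _, _, _, rfl, -⟩ := mem_alternating_one.1 hw
      simp
    · exact alternating_subset_poor _ (shift_mem_alternating_two hw)
    · obtain ⟨_, _, _, _, rfl, -⟩ := mem_alternating_zero.1 hw
      simp
    · exact alternating_subset_poor _ (shift_mem_alternating_one hw)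
  rw [shiftable]
  linarith

/-- Removing the alternating forests from all marked forests increases the density. -/
theorem le_mass_rich {c : ℝ} (hc : 5 ≤ c) (hnil : nil ∈ S') (hsub : S' ⊆ S)
    (hS : weight t S = 1) :
    2 * (mass t (cylinder S [] [S] (K + 3)) + mass t (cylinder S [] [S', S'] (K + 2)) +
        mass t (cylinder S [] [S, S', S'] (K + 1))) + mass t (alternating S S' K 0) -
      c * mass t (cylinder S [] [] (K + 4)) ≤
    2 * (mass t (shiftable S S' K) + mass t (fstJoinable S S' K) + mass t (sndJoinable S S' K)) -
      c * mass t (rich S S' K) := by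
  -- Let `P` be the mass of one position and `Q ≤ 2 P` that of the union of positions `0` and `2`.
  -- The lost edges have mass at most `2 Q`, `P` and `Q` for `x 0`, `x 1` and `x 2`, and the lost
  -- vertices have mass `P + Q`. The gain is at least `5 (P + Q) - 2 (P + 3 Q) = 3 P - Q ≥ P`.
  have h1 := le_mass_shiftable (S' := S') (K := K) ht (hsub hnil)
  have h2 := le_mass_fstJoinable (S := S) (S' := S') (K := K) ht
  have h3 := le_mass_sndJoinable (S := S) (S' := S') (K := K) ht
  have h4 : mass t (rich S S' K) + mass t (poor S S' K) = mass t (cylinder S [] [] (K + 4)) :=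
    sum_sdiff (poor_subset_cylinder (hsub hnil))
  have hdis := disjoint_alternating (S := S) (K := K) hnil
  have h5 : mass t (poor S S' K) = _ := mass_union hdis
  have h6 := mass_union (t := t) (hdis.mono_right subset_union_left)
  have h7 := mass_union_le ht (alternating S S' K 0) (alternating S S' K 2)
  have h8 : mass t (alternating S S' K 1) = mass t (alternating S S' K 0) := by
    simp only [alternating, mass_cylinder hS, List.map_cons, List.map_nil, List.prod_cons,
      List.prod_nil]
    ring
  have h9 : mass t (alternating S S' K 2) = mass t (alternating S S' K 0) := by
    simp only [alternating, mass_cylinder hS, List.map_cons, List.map_nil, List.prod_cons,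
      List.prod_nil]
    ring
  have h10 := mul_nonneg (sub_nonneg.2 hc) (mass_nonneg ht (poor S S' K))
  rw [← h4, mul_add]
  linarith

end MassBounds

end Alternating

theorem exists_dense_mass : ∃ k K, ∃ t : ℝ, 0 < t ∧
    (5 + 1 / 1200) * mass t (rich (trees (k + 1)) (trees k) K) <
      2 * (mass t (shiftable (trees (k + 1)) (trees k) K) +
        mass t (fstJoinable (trees (k + 1)) (trees k) K) +
        mass t (sndJoinable (trees (k + 1)) (trees k) K)) := by
  obtain ⟨k, t, ht1, ht2, hS⟩ := exists_weight_trees_eq_one (η := 1 / 100000) (by norm_num)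
  have ht : 0 < t := by linarith
  -- The gain of about `0.00112` exceeds `1/1200` by more than `0.00028`. This absorbs the loss `4
  -- (t - 1/4)` in the edge masses and the boundary error of order `1 / K`.
  refine ⟨k, 1000000, t, ht, ?_⟩
  have hsub := trees_subset_succ k
  have h := le_mass_rich (K := 1000000) (c := 5 + 1 / 1200) ht (by norm_num) (nil_mem_trees k)
    hsub hS
  refine sub_pos.1 (lt_of_lt_of_le ?_ h)
  have hsq := weight_trees_succ t k
  rw [hS] at hsq
  have hdiff : weight t (trees (k + 1) \ trees k) = 1 - weight t (trees k) := by
    rw [← hS, eq_sub_iff_add_eq]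
    exact sum_sdiff hsub
  have hnil : weight t {nil} = t := by simp [weight]
  simp only [alternating, mass_cylinder hS, List.map_cons, List.map_nil, List.prod_cons,
    List.prod_nil, hS, hdiff, hnil]
  set a := weight t (trees k)
  -- `a ^ 2 = 1 - t ≤ 3/4`, and `0.86603` slightly exceeds `√3 / 2`.
  have ha : a ≤ 0.86603 := by
    by_contra! hlt
    nlinarith
  have hgain : 0.00112 ≤ t * ((1 - a) * (t * (1 - a))) := by
    have h1 : (0.03349 : ℝ) ≤ t * (1 - a) := by nlinarith
    nlinarith
  have hsq' : a ^ 2 = 1 - t := by linarith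
  push_cast
  ring_nf at hgain ⊢
  rw [hsq'] at hgain ⊢
  nlinarith

end MarkedForest

end ThompsonF

end

/-! ### From marked forests to the Cayley graphs. -/

noncomputable section

namespace ThompsonF

open Finset

open scoped Classical in
theorem coe_gens012 : (({x 0, x 1, x 2} : Finset ThompsonF) : Set ThompsonF) = gens012 := by
  simp [gens012]

open scoped Classical in
theorem sum_gens012 (f : ThompsonF → ℕ) :
    ∑ a ∈ ({x 0, x 1, x 2} : Finset ThompsonF), f a = f (x 0) + f (x 1) + f (x 2) := by
  rw [sum_insert (by simp [x_injective.eq_iff]), sum_insert (by simp [x_injective.eq_iff]),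
    sum_singleton, add_assoc]

theorem ncard_src_leftCayleyGraph (w : ThompsonF) :
    {e | (leftCayleyGraph gens012).src e = w}.ncard = 6 := by
  classical
  rw [← coe_gens012]
  refine (leftCayleyGraph_ncard_src _ w).trans ?_
  rw [card_eq_sum_ones, sum_gens012]

theorem ncard_src_rightCayleyGraph (w : ThompsonF) :
    {e | (rightCayleyGraph gens012).src e = w}.ncard = 6 := by
  classical
  rw [← coe_gens012]
  refine (rightCayleyGraph_ncard_src _ w).trans ?_
  rw [card_eq_sum_ones, sum_gens012]

open scoped Classical in
/-- Edges between marked forests of equal size give edges of the Cayley graph. -/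
theorem card_le_card_filter_mul_mem {n : ℕ} {Y E : Finset MarkedForest} {a : ThompsonF}
    {f : MarkedForest → MarkedForest} (hf : ∀ w, (f w).size = w.size)
    (hE : ∀ w ∈ E, w ∈ Y ∧ a * w.val = (f w).val ∧ f w ∈ Y) :
    (E.filter fun w => w.size = n).card ≤
      (((Y.filter fun w => w.size = n).image MarkedForest.val).filter fun g =>
        a * g ∈ (Y.filter fun w => w.size = n).image MarkedForest.val).card := by
  refine card_le_card_of_injOn MarkedForest.val (fun w hw => ?_)
    ((MarkedForest.val_injOn n).mono fun w hw => ?_)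
  · rw [mem_coe, mem_filter] at hw
    obtain ⟨h1, h2, h3⟩ := hE w hw.1
    rw [mem_coe, mem_filter]
    refine ⟨mem_image_of_mem _ (mem_filter.2 ⟨h1, hw.2⟩), ?_⟩
    rw [h2]
    exact mem_image_of_mem _ (mem_filter.2 ⟨h3, (hf w).trans hw.2⟩)
  · exact (mem_filter.1 (mem_coe.1 hw)).2

theorem exists_lt_densityOf : ∃ Y : Finset ThompsonF, Y.Nonempty ∧
    5 + 1 / 1200 < (leftCayleyGraph gens012).densityOf Y := by
  classical
  obtain ⟨k, K, t, ht, h⟩ := MarkedForest.exists_dense_mass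
  obtain ⟨n, hn⟩ := MarkedForest.exists_card_filter_size_lt ht h
  have hsub := trees_subset_succ k
  have hnode : ∀ l ∈ trees k, ∀ r ∈ trees k, BinaryTree.node () l r ∈ trees (k + 1) :=
    fun l hl r hr => node_mem_trees_succ.2 ⟨hl, hr⟩
  have h0 := card_le_card_filter_mul_mem (n := n) MarkedForest.size_shift
    fun w => MarkedForest.shift_mem_rich (S := trees (k + 1)) (S' := trees k) (K := K)
  have h1 := card_le_card_filter_mul_mem (n := n) MarkedForest.size_joinFst
    fun w => MarkedForest.joinFst_mem_rich (K := K) hsub hnode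
  have h2 := card_le_card_filter_mul_mem (n := n) MarkedForest.size_joinSnd
    fun w => MarkedForest.joinSnd_mem_rich (K := K) hsub hnode
  have hcard := card_image_of_injOn (s := (MarkedForest.rich (trees (k + 1)) (trees k) K).filter
    fun w => MarkedForest.size w = n) (f := MarkedForest.val)
    ((MarkedForest.val_injOn n).mono fun w hw => (mem_filter.1 (mem_coe.1 hw)).2)
  rw [← hcard] at hn
  set Y := ((MarkedForest.rich (trees (k + 1)) (trees k) K).filter
    fun w => MarkedForest.size w = n).image MarkedForest.val
  have hsum := sum_ncard_letter_inv_mul_mem {x 0, x 1, x 2} Y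
  rw [sum_gens012, coe_gens012] at hsum
  -- For empty `Y` both sides of the strict inequality `hn` would vanish.
  have hY : Y.Nonempty := by
    rw [nonempty_iff_ne_empty]
    intro hY
    rw [hY] at hn h0 h1 h2
    simp only [filter_empty, card_empty, Nat.le_zero] at h0 h1 h2
    rw [h0, h1, h2] at hn
    simp at hn
  refine ⟨Y, hY, ?_⟩
  rw [leftCayleyGraph_densityOf, lt_div_iff₀ (by exact_mod_cast hY.card_pos), ← Nat.cast_sum, hsum]
  refine hn.trans_le ?_
  exact_mod_cast Nat.mul_le_mul_left 2 (add_le_add (add_le_add h0 h1) h2)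

end ThompsonF

end

theorem theorem2 :
    ((leftCayleyGraph ThompsonF.gens012).cheegerConstant < 1 ∧
      5 < (leftCayleyGraph ThompsonF.gens012).density ∧
      ∃ Y : Finset (leftCayleyGraph ThompsonF.gens012).V, Y.Nonempty ∧
        5 + 1 / 1200 < (leftCayleyGraph ThompsonF.gens012).densityOf Y) ∧
    ((rightCayleyGraph ThompsonF.gens012).cheegerConstant < 1 ∧
      5 < (rightCayleyGraph ThompsonF.gens012).density ∧
      ∃ Y : Finset (rightCayleyGraph ThompsonF.gens012).V, Y.Nonempty ∧
        5 + 1 / 1200 < (rightCayleyGraph ThompsonF.gens012).densityOf Y) := by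
  have hL := ThompsonF.ncard_src_leftCayleyGraph
  have hR := ThompsonF.ncard_src_rightCayleyGraph
  obtain ⟨Y, hY, h⟩ := ThompsonF.exists_lt_densityOf
  have h' := h.trans_eq
    (rightCayleyGraph_densityOf_of_eq_map_inv ThompsonF.gens012 (Y := Y) rfl).symm
  have hY' := (Finset.map_nonempty (f := (Equiv.inv ThompsonF).toEmbedding)).2 hY
  have hl := SerreGraph.cheegerConstant_lt_and_lt_density
    (fun w => Set.finite_of_ncard_ne_zero (by rw [hL w]; norm_num)) hL hY h
  have hr := SerreGraph.cheegerConstant_lt_and_lt_density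
    (fun w => Set.finite_of_ncard_ne_zero (by rw [hR w]; norm_num)) hR hY' h'
  push_cast at hl hr
  exact ⟨⟨hl.1.trans (by norm_num), lt_trans (by norm_num) hl.2, Y, hY, h⟩,
    ⟨hr.1.trans (by norm_num), lt_trans (by norm_num) hr.2, _, hY', h'⟩⟩
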